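/- Let $X$ and $Y$ be Banach spaces and let $1\le p,q<\infty$. For $u\in L^p_{loc}(\mathbb R,X)$ (functions identified when equal a.e.) let $u^b:\mathbb R\to L^p(0,1;X)$, $u^b(t)(\theta)=u(t+\theta)$, be its Bochner transform. Let $S^p_{ap}(\mathbb R,X)$ (resp. $S^p_{aa}(\mathbb R,X)$) be the set of all $u\in L^p_{loc}(\mathbb R,X)$ such that $u^b$ is an almost periodic function in the sense of Bohr (resp. an almost automorphic function) from $\mathbb R$ to $L^p(0,1;X)$, equipped with the norm $$\|u\|_{S^p}=\sup_{t\in\mathbb R}\Big(\int_0^1\|u(t+\theta)\|^p\,d\theta\Big)^{1/p}.$$ Here a continuous function $w:\mathbb R\to E$ into a Banach space $E$ is almost periodic if for every $\varepsilon>0$ there is $\ell>0$ such that every interval $[\alpha,\alpha+\ell]$, $\alpha\in\mathbb R$, contains some $\tau$ with $\sup_{t\in\mathbb R}\|w(t+\tau)-w(t)\|\le\varepsilon$. It is almost automorphic if every real sequence has a subsequence $(t_k)$ for which there is a function $v:\mathbb R\to E$ with $\lim_{k}w(t+t_k)=v(t)$ and $\lim_{k}v(t-t_k)=w(t)$ for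 every $t\in\mathbb R$. Let $f:X\to Y$ be continuous and suppose that there are $a>0$ and $b>0$ such that $$\|f(x)\|\le a\|x\|^{p/q}+b\qquad\text{for all }x\in X.$$ Then: (i) the operator $u\mapsto f\circ u$ maps $S^p_{aa}(\mathbb R,X)$ into $S^q_{aa}(\mathbb R,Y)$, and it is continuous from $S^p_{aa}(\mathbb R,X)$ (with $\|\cdot\|_{S^p}$) to $S^q_{aa}(\mathbb R,Y)$ (with $\|\cdot\|_{S^q}$); (ii) the operator $u\mapsto f\circ u$ maps $S^p_{ap}(\mathbb R,X)$ into $S^q_{ap}(\mathbb R,Y)$, and it is continuous from $S^p_{ap}(\mathbb R,X)$ (with $\|\cdot\|_{S^p}$) to $S^q_{ap}(\mathbb R,Y)$ (with $\|\cdot\|_{S^q}$). -/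

import Mathlib

open MeasureTheory Filter Set
open scoped Topology ENNReal

noncomputable section

namespace Stepanov

/-! ### Almost periodic and almost automorphic functions -/

section Bohr

variable {E : Type*} [NormedAddCommGroup E]

/-- A set `D ⊆ ℝ` is relatively dense if for some `ℓ > 0` it meets every interval of length `ℓ`. -/
def RelativelyDense (D : Set ℝ) : Prop :=
  ∃ ℓ : ℝ, 0 < ℓ ∧ ∀ α : ℝ, (D ∩ Icc α (α + ℓ)).Nonempty

/-- The set of `ε`-almost periods of `u`. -/
def almostPeriods (u : ℝ → E) (ε : ℝ) : Set ℝ :=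
  {τ | ∀ t : ℝ, ‖u (t + τ) - u t‖ ≤ ε}

/-- Almost periodicity in the sense of Bohr. -/
def IsAlmostPeriodic (u : ℝ → E) : Prop :=
  Continuous u ∧ ∀ ε : ℝ, 0 < ε → RelativelyDense (almostPeriods u ε)

/-- Almost automorphy (in the sense of Bochner). -/
def IsAlmostAutomorphic (u : ℝ → E) : Prop :=
  Continuous u ∧ ∀ s : ℕ → ℝ, ∃ φ : ℕ → ℕ, StrictMono φ ∧ ∃ v : ℝ → E, ∀ t : ℝ,
    Tendsto (fun k => u (t + s (φ k))) atTop (𝓝 (v t)) ∧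
    Tendsto (fun k => v (t - s (φ k))) atTop (𝓝 (u t))

theorem IsAlmostPeriodic.bounded {u : ℝ → E} (hu : IsAlmostPeriodic u) :
    ∃ C : ℝ, ∀ t, ‖u t‖ ≤ C := by
  obtain ⟨hc, h⟩ := hu
  obtain ⟨ℓ, -, hd⟩ := h 1 one_pos
  obtain ⟨C, hC⟩ := (isCompact_Icc (a := (0 : ℝ)) (b := ℓ)).exists_bound_of_continuousOn
    hc.continuousOn
  refine ⟨C + 1, fun t => ?_⟩
  obtain ⟨τ, hτ, h1, h2⟩ := hd (-t)
  have h3 := hC (t + τ) ⟨by linarith, by linarith⟩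
  have h4 : ‖u (t + τ) - u t‖ ≤ 1 := hτ t
  have h5 := norm_sub_norm_le (u t) (u (t + τ))
  rw [norm_sub_rev] at h5
  linarith

theorem IsAlmostAutomorphic.bounded {u : ℝ → E} (hu : IsAlmostAutomorphic u) :
    ∃ C : ℝ, ∀ t, ‖u t‖ ≤ C := by
  by_contra! hC
  choose s hs using fun n : ℕ => hC n
  obtain ⟨φ, hφ, v, hv⟩ := hu.2 s
  have h1 := (hv 0).1.norm
  have h2 : Tendsto (fun k => ‖u (0 + s (φ k))‖) atTop atTop := by
    refine tendsto_atTop_mono (fun k => ?_)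
      (tendsto_natCast_atTop_atTop.comp hφ.tendsto_atTop)
    rw [zero_add]
    exact (hs (φ k)).le
  exact not_tendsto_nhds_of_tendsto_atTop h2 _ h1

end Bohr

/-! ### The spaces `L^p_loc(ℝ, X)` and the Bochner transform -/

section Spaces

variable (X : Type*) [NormedAddCommGroup X] (p : ℝ≥0∞)

/-- `L^p_loc(ℝ, X)`: classes (modulo equality a.e.) of strongly measurable functions `ℝ → X` that
are `p`-integrable on every bounded interval `(a, b)`. -/
def LpLoc : AddSubgroup (ℝ →ₘ[volume] X) where
  carrier := {u | ∀ a b : ℝ, MemLp u p (volume.restrict (Ioo a b))}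
  zero_mem' _ _ :=
    (memLp_congr_ae (ae_restrict_of_ae AEEqFun.coeFn_zero)).2 MemLp.zero
  add_mem' {u v} hu hv a b :=
    (memLp_congr_ae (ae_restrict_of_ae (AEEqFun.coeFn_add u v))).2 ((hu a b).add (hv a b))
  neg_mem' {u} hu a b :=
    (memLp_congr_ae (ae_restrict_of_ae (AEEqFun.coeFn_neg u))).2 (hu a b).neg

variable {X p}

theorem measurePreserving_shift (t a b : ℝ) :
    MeasurePreserving (fun θ : ℝ => t + θ) (volume.restrict (Ioo a b))
      (volume.restrict (Ioo (t + a) (t + b))) := by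
  have h := (measurePreserving_add_left (volume : Measure ℝ) t).restrict_preimage
    (s := Ioo (t + a) (t + b)) measurableSet_Ioo
  simpa using h

theorem memLp_shift (u : LpLoc X p) (t : ℝ) :
    MemLp (fun θ : ℝ => u.1 (t + θ)) p (volume.restrict (Ioo (0 : ℝ) 1)) :=
  (u.2 (t + 0) (t + 1)).comp_measurePreserving (measurePreserving_shift t 0 1)

/-- The Bochner transform `u^b : ℝ → L^p(0,1; X)`, `u^b(t)(θ) = u(t + θ)`. -/
def bochnerTransform (u : LpLoc X p) (t : ℝ) : Lp X p (volume.restrict (Ioo (0 : ℝ) 1)) :=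
  (memLp_shift u t).toLp (fun θ : ℝ => u.1 (t + θ))

theorem ae_shift {P : ℝ → Prop} (h : ∀ᵐ s, P s) (t : ℝ) :
    ∀ᵐ θ ∂(volume.restrict (Ioo (0 : ℝ) 1)), P (t + θ) :=
  ae_restrict_of_ae
    ((measurePreserving_add_left (volume : Measure ℝ) t).quasiMeasurePreserving.ae h)

theorem bochnerTransform_zero (t : ℝ) : bochnerTransform (0 : LpLoc X p) t = 0 := by
  apply Lp.ext
  refine (MemLp.coeFn_toLp _).trans (EventuallyEq.trans ?_ (Lp.coeFn_zero _ _ _).symm)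
  exact ae_shift (P := fun s => (0 : LpLoc X p).1 s = 0) AEEqFun.coeFn_zero t

theorem bochnerTransform_add (u v : LpLoc X p) (t : ℝ) :
    bochnerTransform (u + v) t = bochnerTransform u t + bochnerTransform v t := by
  unfold bochnerTransform
  rw [← MemLp.toLp_add]
  refine MemLp.toLp_congr _ _ ?_
  exact ae_shift (P := fun s => (u + v).1 s = u.1 s + v.1 s) (AEEqFun.coeFn_add u.1 v.1) t

theorem bochnerTransform_neg (u : LpLoc X p) (t : ℝ) :
    bochnerTransform (-u) t = -bochnerTransform u t := by
  unfold bochnerTransform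
  rw [← MemLp.toLp_neg]
  refine MemLp.toLp_congr _ _ ?_
  exact ae_shift (P := fun s => (-u).1 s = -u.1 s) (AEEqFun.coeFn_neg u.1) t

theorem eq_zero_of_bochnerTransform {u : LpLoc X p} (h : ∀ t, bochnerTransform u t = 0) :
    u = 0 := by
  have key : ∀ n : ℤ, ∀ᵐ s ∂(volume.restrict (Ioo (n : ℝ) (n + 1))), u.1 s = 0 := by
    intro n
    have h1 : ∀ᵐ θ ∂(volume.restrict (Ioo (0 : ℝ) 1)), u.1 ((n : ℝ) + θ) = 0 := by
      have h2 := h (n : ℝ)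
      have h3 := (MemLp.coeFn_toLp (memLp_shift u (n : ℝ)))
      have h4 : (bochnerTransform u (n : ℝ) : ℝ → X) =ᵐ[volume.restrict (Ioo (0 : ℝ) 1)] 0 := by
        rw [h2]; exact Lp.coeFn_zero _ _ _
      filter_upwards [h3, h4] with θ h5 h6
      rw [← h5]; exact h6
    have h7 := (measurePreserving_shift (-(n : ℝ)) n (n + 1))
    have h8 : Ioo (-(n : ℝ) + n) (-(n : ℝ) + (n + 1)) = Ioo 0 1 := by
      congr 1 <;> ring
    rw [h8] at h7
    filter_upwards [h7.quasiMeasurePreserving.ae h1] with s hs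
    simpa using hs
  have hall : ∀ᵐ s : ℝ, u.1 s = 0 := by
    have h1 : ∀ᵐ s : ℝ, ∀ n : ℤ, s ∈ Ioo (n : ℝ) (n + 1) → u.1 s = 0 :=
      ae_all_iff.2 fun n => (ae_restrict_iff' measurableSet_Ioo).1 (key n)
    have h2 : ∀ᵐ s : ℝ, ∀ n : ℤ, s ≠ (n : ℝ) := ae_all_iff.2 fun n => by
      simp [ae_iff]
    filter_upwards [h1, h2] with s hs1 hs2
    exact hs1 ⌊s⌋ ⟨lt_of_le_of_ne (Int.floor_le s) (hs2 _).symm, Int.lt_floor_add_one s⟩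
  apply Subtype.ext
  apply AEEqFun.ext
  exact EventuallyEq.trans (g := (0 : ℝ → X)) hall AEEqFun.coeFn_zero.symm

end Spaces

/-! ### Stepanov spaces -/

section StepanovSpaces

variable (X : Type*) [NormedAddCommGroup X] (p : ℝ≥0∞) [Fact (1 ≤ p)]

/-- `BS^p(ℝ, X)`: those `u ∈ L^p_loc(ℝ, X)` whose Bochner transform is bounded. -/
def StepanovBounded : AddSubgroup (LpLoc X p) where
  carrier := {u | ∃ C : ℝ, ∀ t : ℝ, ‖bochnerTransform u t‖ ≤ C}
  zero_mem' := ⟨0, fun t => by simp [bochnerTransform_zero]⟩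
  add_mem' := by
    rintro u v ⟨C, hC⟩ ⟨D, hD⟩
    refine ⟨C + D, fun t => ?_⟩
    rw [bochnerTransform_add]
    exact (norm_add_le _ _).trans (add_le_add (hC t) (hD t))
  neg_mem' := by
    rintro u ⟨C, hC⟩
    refine ⟨C, fun t => ?_⟩
    rw [bochnerTransform_neg, norm_neg]
    exact hC t

variable {X p}

theorem StepanovBounded.bddAbove (u : StepanovBounded X p) :
    BddAbove (range fun t : ℝ => ‖bochnerTransform u.1 t‖) := by
  obtain ⟨C, hC⟩ := u.2
  exact ⟨C, by rintro _ ⟨t, rfl⟩; exact hC t⟩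

variable (X p)

/-- The Stepanov norm `‖u‖_{S^p} = sup_t ‖u^b(t)‖_{L^p(0,1; X)}`. -/
def stepanovNorm : AddGroupNorm (StepanovBounded X p) where
  toFun u := ⨆ t : ℝ, ‖bochnerTransform u.1 t‖
  map_zero' := by
    simp [bochnerTransform_zero]
  add_le' u v := by
    refine ciSup_le fun t => ?_
    have : bochnerTransform (u + v).1 t = bochnerTransform u.1 t + bochnerTransform v.1 t :=
      bochnerTransform_add u.1 v.1 t
    rw [this]
    exact (norm_add_le _ _).trans
      (add_le_add (le_ciSup (StepanovBounded.bddAbove u) t) (le_ciSup (StepanovBounded.bddAbove v) t))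
  neg' u := by
    simp [bochnerTransform_neg]
  eq_zero_of_map_eq_zero' u hu := by
    apply Subtype.ext
    refine eq_zero_of_bochnerTransform fun t => ?_
    have := le_ciSup (StepanovBounded.bddAbove u) t
    rw [show (⨆ t : ℝ, ‖bochnerTransform u.1 t‖) = 0 from hu] at this
    exact norm_le_zero_iff.1 this

instance : NormedAddCommGroup (StepanovBounded X p) :=
  (stepanovNorm X p).toNormedAddCommGroup

/-- `S^p_ap(ℝ, X)`: Stepanov almost periodic functions of exponent `p`. -/
def StepanovAP : Set (LpLoc X p) := {u | IsAlmostPeriodic (bochnerTransform u)}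

/-- `S^p_aa(ℝ, X)`: Stepanov almost automorphic functions of exponent `p`. -/
def StepanovAA : Set (LpLoc X p) := {u | IsAlmostAutomorphic (bochnerTransform u)}

variable {X p}

/-- The inclusion of `S^p_ap(ℝ, X)` into `BS^p(ℝ, X)`. -/
def StepanovAP.toBounded (u : StepanovAP X p) : StepanovBounded X p :=
  ⟨u.1, IsAlmostPeriodic.bounded u.2⟩

/-- The inclusion of `S^p_aa(ℝ, X)` into `BS^p(ℝ, X)`. -/
def StepanovAA.toBounded (u : StepanovAA X p) : StepanovBounded X p :=
  ⟨u.1, IsAlmostAutomorphic.bounded u.2⟩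

/-- `S^p_ap(ℝ, X)` with the distance `‖u - v‖_{S^p}`. -/
instance : MetricSpace (StepanovAP X p) :=
  MetricSpace.induced StepanovAP.toBounded
    (fun _ _ h => Subtype.ext (congrArg (fun w => w.1) h)) inferInstance

/-- `S^p_aa(ℝ, X)` with the distance `‖u - v‖_{S^p}`. -/
instance : MetricSpace (StepanovAA X p) :=
  MetricSpace.induced StepanovAA.toBounded
    (fun _ _ h => Subtype.ext (congrArg (fun w => w.1) h)) inferInstance

end StepanovSpaces

end Stepanov

end

namespace Stepanov

/-! ### The Nemytskii operator on Lebesgue spaces -/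

section Nemytskii

variable {α X Y : Type*} {m : MeasurableSpace α} {μ : Measure α}
  [NormedAddCommGroup X] [NormedAddCommGroup Y] {p q : ℝ≥0∞} {f : X → Y} {a b : ℝ}

/-! The growth bound makes `g ↦ f ∘ g` a continuous map `F` from `L^p(0,1; X)` to `L^q(0,1; Y)`, and
the Bochner transform of `f ∘ u` is `F ∘ u^b`. Everything thus reduces to composing a vector-valued
function with a continuous `F`. `F` need not be uniformly continuous, but almost periodic and almost
automorphic functions have relatively compact range, and near a compact set a continuous map has a
uniform modulus (`exists_uniform_delta`). This yields both the preservation of almost periodicity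
and the continuity for the sup norms. -/

theorem mul_ofReal_toReal_div (hq1 : 1 ≤ q) (hp : p ≠ ∞) (hq : q ≠ ∞) :
    q * ENNReal.ofReal (p.toReal / q.toReal) = p := by
  have hq0 : 0 < q.toReal := ENNReal.toReal_pos (one_pos.trans_le hq1).ne' hq
  rw [ENNReal.ofReal_div_of_pos hq0, ENNReal.ofReal_toReal hp, ENNReal.ofReal_toReal hq]
  exact ENNReal.mul_div_cancel (one_pos.trans_le hq1).ne' hq

theorem memLp_comp_of_growth [IsFiniteMeasure μ] (hp1 : 1 ≤ p) (hq1 : 1 ≤ q) (hp : p ≠ ∞)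
    (hq : q ≠ ∞) (hf : Continuous f)
    (hgrowth : ∀ x : X, ‖f x‖ ≤ a * ‖x‖ ^ (p.toReal / q.toReal) + b)
    {u : α → X} (hu : MemLp u p μ) : MemLp (f ∘ u) q μ := by
  have hp0 : 0 < p.toReal := ENNReal.toReal_pos (one_pos.trans_le hp1).ne' hp
  have hq0 : 0 < q.toReal := ENNReal.toReal_pos (one_pos.trans_le hq1).ne' hq
  have h1 : MemLp (fun x => ‖u x‖ ^ (p.toReal / q.toReal)) q μ := by
    refine ⟨(hu.1.norm.aemeasurable.pow_const _).aestronglyMeasurable, ?_⟩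
    rw [eLpNorm_norm_rpow _ (div_pos hp0 hq0), mul_ofReal_toReal_div hq1 hp hq]
    exact ENNReal.rpow_lt_top_of_nonneg (div_pos hp0 hq0).le hu.2.ne
  refine MemLp.mono' (g := fun x => a * ‖u x‖ ^ (p.toReal / q.toReal) + b)
    ((h1.const_mul a).add (memLp_const b)) (hf.comp_aestronglyMeasurable hu.1) ?_
  exact Eventually.of_forall fun x => hgrowth (u x)

theorem UnifIntegrable.norm_rpow {ι : Type*} (hp1 : 1 ≤ p) (hq1 : 1 ≤ q) (hp : p ≠ ∞)
    (hq : q ≠ ∞) {u : ι → α → X} (hu : UnifIntegrable u p μ) :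
    UnifIntegrable (fun i x => ‖u i x‖ ^ (p.toReal / q.toReal)) q μ := by
  have hp0 : 0 < p.toReal := ENNReal.toReal_pos (one_pos.trans_le hp1).ne' hp
  have hq0 : 0 < q.toReal := ENNReal.toReal_pos (one_pos.trans_le hq1).ne' hq
  have hr : 0 < p.toReal / q.toReal := div_pos hp0 hq0
  intro ε hε
  -- With `r = p / q`, the `L^q` norm of `‖u‖ ^ r` is the `r`-th power of the `L^p` norm of `u`;
  -- hence the tolerance `ε ^ (1 / r)`.
  obtain ⟨δ, hδ, h⟩ := hu (Real.rpow_pos_of_pos hε (p.toReal / q.toReal)⁻¹)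
  refine ⟨δ, hδ, fun i s hs hμ => ?_⟩
  have h1 : s.indicator (fun x => ‖u i x‖ ^ (p.toReal / q.toReal)) =
      fun x => ‖s.indicator (u i) x‖ ^ (p.toReal / q.toReal) := by
    ext x
    by_cases hx : x ∈ s <;> simp [hx, Real.zero_rpow hr.ne']
  rw [h1, eLpNorm_norm_rpow _ hr, mul_ofReal_toReal_div hq1 hp hq]
  refine (ENNReal.rpow_le_rpow (h i s hs hμ) hr.le).trans_eq ?_
  rw [ENNReal.ofReal_rpow_of_pos (Real.rpow_pos_of_pos hε _), ← Real.rpow_mul hε.le,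
    inv_mul_cancel₀ hr.ne', Real.rpow_one]

theorem UnifIntegrable.const_mul {ι : Type*} {u : ι → α → ℝ} (hu : UnifIntegrable u q μ)
    (ha : 0 < a) : UnifIntegrable (fun i x => a * u i x) q μ := by
  intro ε hε
  obtain ⟨δ, hδ, h⟩ := hu (div_pos hε ha)
  refine ⟨δ, hδ, fun i s hs hμ => ?_⟩
  have h1 : s.indicator (fun x => a * u i x) = a • s.indicator (u i) := by
    ext x
    by_cases hx : x ∈ s <;> simp [hx]
  rw [h1, eLpNorm_const_smul]
  calc ‖a‖ₑ * eLpNorm (s.indicator (u i)) q μ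
      ≤ ENNReal.ofReal a * ENNReal.ofReal (ε / a) := by
        rw [Real.enorm_of_nonneg ha.le]
        gcongr
        exact h i s hs hμ
    _ = ENNReal.ofReal ε := by
        rw [← ENNReal.ofReal_mul ha.le, mul_div_cancel₀ _ ha.ne']

theorem UnifIntegrable.mono_norm {ι : Type*} {u : ι → α → X} {v : ι → α → Y}
    (hv : UnifIntegrable v q μ) (h : ∀ i x, ‖u i x‖ ≤ ‖v i x‖) : UnifIntegrable u q μ := by
  intro ε hε
  obtain ⟨δ, hδ, hd⟩ := hv hε
  refine ⟨δ, hδ, fun i s hs hμ => (eLpNorm_mono fun x => ?_).trans (hd i s hs hμ)⟩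
  by_cases hx : x ∈ s <;> simp [hx, h i x]

theorem UnifIntegrable.comp_of_growth [IsFiniteMeasure μ] {ι : Type*} (hp1 : 1 ≤ p) (hq1 : 1 ≤ q)
    (hp : p ≠ ∞) (hq : q ≠ ∞) (ha : 0 < a)
    (hgrowth : ∀ x : X, ‖f x‖ ≤ a * ‖x‖ ^ (p.toReal / q.toReal) + b) {u : ι → α → X}
    (hum : ∀ i, AEStronglyMeasurable (u i) μ) (hu : UnifIntegrable u p μ) :
    UnifIntegrable (fun i => f ∘ u i) q μ := by
  have h1 := UnifIntegrable.const_mul (UnifIntegrable.norm_rpow hp1 hq1 hp hq hu) ha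
  have h2 : UnifIntegrable (fun (_ : ι) (_ : α) => b) q μ :=
    unifIntegrable_const hq1 hq (memLp_const b)
  refine UnifIntegrable.mono_norm (h1.add h2 hq1 (fun i => ?_) fun _ =>
    aestronglyMeasurable_const) fun i x => ?_
  · exact (((hum i).norm.aemeasurable.pow_const _).const_mul a).aestronglyMeasurable
  · exact (hgrowth (u i x)).trans (le_abs_self _)

/-- On a finite measure space, convergence in measure means that every subsequence has a further one
converging a.e.; mere continuity of `f` preserves this. -/
theorem tendstoInMeasure_comp [IsFiniteMeasure μ] (hf : Continuous f) {u : ℕ → α → X} {v : α → X}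
    (hum : ∀ i, AEStronglyMeasurable (u i) μ) (h : TendstoInMeasure μ u atTop v) :
    TendstoInMeasure μ (fun i => f ∘ u i) atTop (f ∘ v) := by
  refine (exists_seq_tendstoInMeasure_atTop_iff fun n =>
    hf.comp_aestronglyMeasurable (hum n)).2 fun ns hns => ?_
  obtain ⟨ns', hns', h'⟩ := (exists_seq_tendstoInMeasure_atTop_iff hum).1 h ns hns
  refine ⟨ns', hns', ?_⟩
  filter_upwards [h'] with x hx
  exact (hf.tendsto _).comp hx

/-- A continuous function of growth `‖f x‖ ≤ a ‖x‖ ^ (p / q) + b` induces a continuous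
superposition operator from `L^p` to `L^q` over a finite measure. -/
theorem exists_continuous_superposition [IsFiniteMeasure μ] [Fact (1 ≤ p)] [Fact (1 ≤ q)]
    (hp : p ≠ ∞) (hq : q ≠ ∞) (hf : Continuous f) (ha : 0 < a)
    (hgrowth : ∀ x : X, ‖f x‖ ≤ a * ‖x‖ ^ (p.toReal / q.toReal) + b) :
    ∃ F : Lp X p μ → Lp Y q μ, Continuous F ∧ ∀ g, F g =ᵐ[μ] f ∘ g := by
  have hp1 : 1 ≤ p := Fact.out
  have hq1 : 1 ≤ q := Fact.out
  have hmem (g : Lp X p μ) : MemLp (f ∘ g) q μ :=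
    memLp_comp_of_growth hp1 hq1 hp hq hf hgrowth (Lp.memLp g)
  refine ⟨fun g => (hmem g).toLp _, ?_, fun g => (hmem g).coeFn_toLp⟩
  refine continuous_iff_seqContinuous.2 fun g g₀ hg => ?_
  have hm (n : ℕ) : AEStronglyMeasurable (g n) μ := Lp.aestronglyMeasurable _
  refine (Lp.tendsto_Lp_iff_tendsto_eLpNorm'' _ (fun n => hmem (g n)) _ (hmem g₀)).2 ?_
  -- Vitali's theorem: uniform integrability and convergence in measure both pass from `g n` to `f ∘
  -- g n`.
  refine tendsto_Lp_finite_of_tendstoInMeasure hq1 hq (fun n => (hmem (g n)).1) (hmem g₀) ?_ ?_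
  · refine UnifIntegrable.comp_of_growth hp1 hq1 hp hq ha hgrowth hm ?_
    exact unifIntegrable_of_tendsto_Lp hp1 hp (fun n => Lp.memLp _) (Lp.memLp g₀)
      ((Lp.tendsto_Lp_iff_tendsto_eLpNorm' _ _).1 hg)
  · exact tendstoInMeasure_comp hf hm (tendstoInMeasure_of_tendsto_Lp hg)

end Nemytskii

/-! ### Composition with continuous maps -/

section Composition

variable {E E' : Type*} [NormedAddCommGroup E] [NormedAddCommGroup E']

theorem IsAlmostAutomorphic.isCompact_closure_range {w : ℝ → E} (hw : IsAlmostAutomorphic w) :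
    IsCompact (closure (range w)) := by
  refine IsSeqCompact.isCompact fun x hx => ?_
  -- Points of the closure are replaced by values of `w` at distance tending to `0`; almost
  -- automorphy at `t = 0` then gives a convergent subsequence.
  have hs (n : ℕ) : ∃ s : ℝ, dist (x n) (w s) < 1 / ((n : ℝ) + 1) := by
    obtain ⟨_, ⟨s, rfl⟩, h⟩ := Metric.mem_closure_iff.1 (hx n) _ (Nat.one_div_pos_of_nat (n := n))
    exact ⟨s, h⟩
  choose s hs using hs
  obtain ⟨φ, hφ, v, hv⟩ := hw.2 s
  have h1 := (hv 0).1
  simp only [zero_add] at h1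
  refine ⟨v 0, mem_closure_of_tendsto h1 (Eventually.of_forall fun _ => mem_range_self _), φ, hφ,
    (tendsto_iff_of_dist ?_).2 h1⟩
  exact squeeze_zero (fun _ => dist_nonneg) (fun n => (hs (φ n)).le)
    (tendsto_one_div_add_atTop_nhds_zero_nat.comp hφ.tendsto_atTop)

theorem IsAlmostPeriodic.isCompact_closure_range [CompleteSpace E] {w : ℝ → E}
    (hw : IsAlmostPeriodic w) : IsCompact (closure (range w)) := by
  refine TotallyBounded.isCompact_of_isClosed (TotallyBounded.closure ?_) isClosed_closure
  refine Metric.totallyBounded_iff.2 fun ε hε => ?_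
  obtain ⟨ℓ, -, hd⟩ := hw.2 (ε / 2) (half_pos hε)
  obtain ⟨t, ht, hcover⟩ := Metric.totallyBounded_iff.1
    ((isCompact_Icc (a := (0 : ℝ)) (b := ℓ)).image hw.1).totallyBounded (ε / 2) (half_pos hε)
  refine ⟨t, ht, ?_⟩
  rintro _ ⟨s, rfl⟩
  -- This almost period carries `s` into `[0, ℓ]`, so the compact set `w([0, ℓ])` is `ε / 2`-dense
  -- in the range.
  obtain ⟨τ, hτ, h1, h2⟩ := hd (-s)
  have h3 := hcover (mem_image_of_mem w (show s + τ ∈ Icc 0 ℓ from ⟨by linarith, by linarith⟩))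
  simp only [mem_iUnion, Metric.mem_ball, exists_prop] at h3 ⊢
  obtain ⟨y, hy, h4⟩ := h3
  refine ⟨y, hy, ?_⟩
  have h5 : dist (w s) (w (s + τ)) ≤ ε / 2 := by
    rw [dist_comm, dist_eq_norm]
    exact hτ s
  linarith [dist_triangle (w s) (w (s + τ)) y]

/-- Only `x` is confined to `K`: in the continuity of the Nemytskii operator, the perturbed
transform may leave the compact set. -/
theorem exists_uniform_delta {F : E → E'} (hF : Continuous F) {K : Set E} (hK : IsCompact K)
    {ε : ℝ} (hε : 0 < ε) :
    ∃ δ > 0, ∀ x ∈ K, ∀ y, ‖y - x‖ < δ → ‖F y - F x‖ < ε := by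
  obtain ⟨δ, hδ, h⟩ := Metric.mem_uniformity_dist.1
    (hK.uniformContinuousAt_of_continuousAt F (fun _ _ => hF.continuousAt)
      (Metric.dist_mem_uniformity hε))
  refine ⟨δ, hδ, fun x hx y hxy => ?_⟩
  rw [← dist_eq_norm, dist_comm] at hxy ⊢
  exact h hxy hx

/-- Both limits in the definition are pointwise in `t`, so no compactness is needed. -/
theorem IsAlmostAutomorphic.comp {F : E → E'} (hF : Continuous F) {w : ℝ → E}
    (hw : IsAlmostAutomorphic w) : IsAlmostAutomorphic (F ∘ w) := by
  refine ⟨hF.comp hw.1, fun s => ?_⟩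
  obtain ⟨φ, hφ, v, hv⟩ := hw.2 s
  exact ⟨φ, hφ, F ∘ v, fun t => ⟨(hF.tendsto _).comp (hv t).1, (hF.tendsto _).comp (hv t).2⟩⟩

theorem IsAlmostPeriodic.comp [CompleteSpace E] {F : E → E'} (hF : Continuous F) {w : ℝ → E}
    (hw : IsAlmostPeriodic w) : IsAlmostPeriodic (F ∘ w) := by
  refine ⟨hF.comp hw.1, fun ε hε => ?_⟩
  obtain ⟨δ, hδ, h⟩ := exists_uniform_delta hF hw.isCompact_closure_range hε
  obtain ⟨ℓ, hℓ, hd⟩ := hw.2 (δ / 2) (half_pos hδ)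
  -- Every `δ / 2`-almost period of `w` is an `ε`-almost period of `F ∘ w`.
  refine ⟨ℓ, hℓ, fun α => (hd α).mono (inter_subset_inter_left _ fun τ hτ t => ?_)⟩
  exact (h _ (subset_closure (mem_range_self t)) _ ((hτ t).trans_lt (half_lt_self hδ))).le

end Composition

/-! ### The Nemytskii operator on Stepanov spaces -/

section Stepanov

variable {X Y : Type*} [NormedAddCommGroup X] [NormedAddCommGroup Y] {p q : ℝ≥0∞} {f : X → Y}

theorem bochnerTransform_sub (u v : LpLoc X p) (t : ℝ) :
    bochnerTransform (u - v) t = bochnerTransform u t - bochnerTransform v t := by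
  rw [sub_eq_add_neg, bochnerTransform_add, bochnerTransform_neg, sub_eq_add_neg]

/-- If `F` is the superposition operator of `f` on `L^p(0,1; X)`, the Bochner transform of
`f ∘ u` is `F ∘ u^b`. -/
theorem bochnerTransform_comp
    {F : Lp X p (volume.restrict (Ioo (0 : ℝ) 1)) → Lp Y q (volume.restrict (Ioo (0 : ℝ) 1))}
    (hF : ∀ g, F g =ᵐ[volume.restrict (Ioo (0 : ℝ) 1)] f ∘ g) {u : LpLoc X p} {v : LpLoc Y q}
    (h : ∀ᵐ t : ℝ, v.1 t = f (u.1 t)) : bochnerTransform v = F ∘ bochnerTransform u := by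
  ext1 t
  apply Lp.ext
  filter_upwards [(memLp_shift v t).coeFn_toLp, (memLp_shift u t).coeFn_toLp,
    hF (bochnerTransform u t), ae_shift h t] with θ h1 h2 h3 h4
  rw [Function.comp_apply, h3, Function.comp_apply]
  exact (h1.trans h4).trans (congrArg f h2).symm

theorem exists_comp_mem_LpLoc [Fact (1 ≤ p)] [Fact (1 ≤ q)] (hp : p ≠ ∞) (hq : q ≠ ∞)
    (hf : Continuous f) {a b : ℝ}
    (hgrowth : ∀ x : X, ‖f x‖ ≤ a * ‖x‖ ^ (p.toReal / q.toReal) + b) (u : LpLoc X p) :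
    ∃ v : LpLoc Y q, ∀ᵐ t : ℝ, v.1 t = f (u.1 t) := by
  have h := AEEqFun.coeFn_comp f hf u.1
  refine ⟨⟨AEEqFun.comp f hf u.1, fun c d => ?_⟩, h⟩
  exact (memLp_congr_ae (ae_restrict_of_ae h)).2
    (memLp_comp_of_growth Fact.out Fact.out hp hq hf hgrowth (u.2 c d))

variable [Fact (1 ≤ p)] [Fact (1 ≤ q)]

theorem StepanovBounded.dist_eq (u v : StepanovBounded X p) :
    dist u v = ⨆ t : ℝ, ‖bochnerTransform u.1 t - bochnerTransform v.1 t‖ := by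
  rw [dist_eq_norm]
  change (⨆ t : ℝ, ‖bochnerTransform (u.1 - v.1) t‖) = _
  simp_rw [bochnerTransform_sub]

theorem StepanovBounded.norm_bochnerTransform_sub_le (u v : StepanovBounded X p) (t : ℝ) :
    ‖bochnerTransform u.1 t - bochnerTransform v.1 t‖ ≤ dist u v := by
  rw [dist_eq_norm, ← bochnerTransform_sub]
  exact le_ciSup (StepanovBounded.bddAbove (u - v)) t

/-- Closeness to a function whose Bochner transform has
relatively compact range is preserved by a continuous superposition operator. -/
theorem StepanovBounded.exists_delta_comp
    {F : Lp X p (volume.restrict (Ioo (0 : ℝ) 1)) → Lp Y q (volume.restrict (Ioo (0 : ℝ) 1))}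
    (hFc : Continuous F) {u : StepanovBounded X p}
    (hu : IsCompact (closure (range (bochnerTransform u.1)))) {ε : ℝ} (hε : 0 < ε) :
    ∃ δ > 0, ∀ (v : StepanovBounded X p) (u' v' : StepanovBounded Y q),
      bochnerTransform u'.1 = F ∘ bochnerTransform u.1 →
      bochnerTransform v'.1 = F ∘ bochnerTransform v.1 → dist v u < δ → dist v' u' < ε := by
  -- A supremum of quantities below `ε / 2` is only `≤ ε / 2`; halving keeps the final inequality
  -- strict.
  obtain ⟨δ, hδ, h⟩ := exists_uniform_delta hFc hu (half_pos hε)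
  refine ⟨δ, hδ, fun v u' v' hu' hv' hd => ?_⟩
  refine lt_of_le_of_lt ?_ (half_lt_self hε)
  rw [StepanovBounded.dist_eq]
  refine ciSup_le fun t => ?_
  rw [hu', hv']
  exact (h _ (subset_closure (mem_range_self t)) _
    ((StepanovBounded.norm_bochnerTransform_sub_le v u t).trans_lt hd)).le

end Stepanov

end Stepanov

/-- For a continuous `f : X → Y` of growth `‖f x‖ ≤ a ‖x‖ ^ (p / q) + b`, the Nemytskii operator
`u ↦ f ∘ u` is a well-defined continuous map `S^p_aa(ℝ, X) → S^q_aa(ℝ, Y)` and a well-defined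
continuous map `S^p_ap(ℝ, X) → S^q_ap(ℝ, Y)`. -/
theorem mainTheorem9
    {X : Type*} [NormedAddCommGroup X] [NormedSpace ℝ X] [CompleteSpace X]
    {Y : Type*} [NormedAddCommGroup Y] [NormedSpace ℝ Y] [CompleteSpace Y]
    (p q : ℝ≥0∞) [Fact (1 ≤ p)] [Fact (1 ≤ q)] (hp : p ≠ ∞) (hq : q ≠ ∞)
    (f : X → Y) (hf : Continuous f) (a b : ℝ) (ha : 0 < a) (hb : 0 < b)
    (hgrowth : ∀ x : X, ‖f x‖ ≤ a * ‖x‖ ^ (p.toReal / q.toReal) + b) :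
    (∃ N : Stepanov.StepanovAA X p → Stepanov.StepanovAA Y q,
      (∀ u : Stepanov.StepanovAA X p, ∀ᵐ t : ℝ, (N u).1.1 t = f (u.1.1 t)) ∧ Continuous N) ∧
    (∃ N : Stepanov.StepanovAP X p → Stepanov.StepanovAP Y q,
      (∀ u : Stepanov.StepanovAP X p, ∀ᵐ t : ℝ, (N u).1.1 t = f (u.1.1 t)) ∧ Continuous N) := by
  obtain ⟨F, hFc, hF⟩ := Stepanov.exists_continuous_superposition
    (μ := volume.restrict (Ioo (0 : ℝ) 1)) hp hq hf ha hgrowth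
  choose N₀ hN₀ using Stepanov.exists_comp_mem_LpLoc hp hq hf hgrowth
  have hN (u : Stepanov.LpLoc X p) :
      Stepanov.bochnerTransform (N₀ u) = F ∘ Stepanov.bochnerTransform u :=
    Stepanov.bochnerTransform_comp hF (hN₀ u)
  refine ⟨⟨fun u => ⟨N₀ u.1, ?_⟩, fun u => hN₀ u.1, ?_⟩, ⟨fun u => ⟨N₀ u.1, ?_⟩,
    fun u => hN₀ u.1, ?_⟩⟩
  · change Stepanov.IsAlmostAutomorphic _
    rw [hN]
    exact Stepanov.IsAlmostAutomorphic.comp hFc u.2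
  · refine Metric.continuous_iff.2 fun u ε hε => ?_
    obtain ⟨δ, hδ, h⟩ := Stepanov.StepanovBounded.exists_delta_comp hFc
      (u := Stepanov.StepanovAA.toBounded u)
      (Stepanov.IsAlmostAutomorphic.isCompact_closure_range u.2) hε
    exact ⟨δ, hδ, fun v hv => h (Stepanov.StepanovAA.toBounded v) _ _ (hN u.1) (hN v.1) hv⟩
  · change Stepanov.IsAlmostPeriodic _
    rw [hN]
    exact Stepanov.IsAlmostPeriodic.comp hFc u.2
  · refine Metric.continuous_iff.2 fun u ε hε => ?_
    obtain ⟨δ, hδ, h⟩ := Stepanov.StepanovBounded.exists_delta_comp hFc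
      (u := Stepanov.StepanovAP.toBounded u)
      (Stepanov.IsAlmostPeriodic.isCompact_closure_range u.2) hε
    exact ⟨δ, hδ, fun v hv => h (Stepanov.StepanovAP.toBounded v) _ _ (hN u.1) (hN v.1) hv⟩
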